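/- Let $p\ge 0$, $\vec a=[a_1,\dots,a_p]\in\mathbb C^p$, let $K\ge 1$ be an integer and let $\sigma\in\mathbb C$ satisfy $2\sigma\notin\mathbb Z$ and $a_i\pm\sigma\notin\{-1,-2,-3,\dots\}$ for all $i$. Put $$P(\vec a;z)=\prod_{i}(z+a_i),\qquad \Gamma(\vec a;z)=\prod_i\Gamma(z+a_i),\qquad G(\vec a;z)=\prod_i G(z+a_i),$$ where $G$ is Barnes' $G$-function (empty products are $1$). For partitions $\lambda,\mu$ with transposes $\lambda',\mu'$ and hook lengths $h_\lambda(i,j)=\lambda_i-i+\lambda'_j-j+1$ let $$\mathcal B_{\lambda,\mu}(\vec a;\sigma)=\prod_{(i,j)\in\lambda}\frac{P(\vec a;i-j+\sigma)}{h_\lambda^2(i,j)(\lambda'_j+\mu_i-i-j+1+2\sigma)^2}\prod_{(i,j)\in\mu}\frac{P(\vec a;i-j-\sigma)}{h_\mu^2(i,j)(\lambda_i+\mu'_j-i-j+1-2\sigma)^2},$$ where $(i,j)\in\lambda$ means $1\le j\le\lambda_i$. Let $$Q(\vec a,K,\sigma)=\frac{G(\vec a;K+1+\sigma)G(\vec a;K+1-\sigma)}{G(\vec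 a;1+\sigma)G(\vec a;1-\sigma)}\Gamma(2\sigma)^{2K}\Gamma(1-2\sigma)^{2K},\qquad w(z)=\frac{1}{\Gamma(\vec a;K-z)\Gamma(z+1+\sigma)^2\Gamma(z+1-\sigma)^2},$$ and for $q\in\mathbb C\setminus\{0\}$ let $\nu=\nu_{\vec a,K,\sigma;q}$ be the discrete complex measure $$\nu=q\sum_{k=0}^\infty w(k+\sigma)\,\delta_{k+\sigma}+q^{-1}\sum_{k=0}^\infty w(k-\sigma)\,\delta_{k-\sigma}.$$ Let $t=e^u$ with $u\in\mathbb C$, and write $t^x=e^{ux}$ for $x\in\mathbb C$ (so any branch of the logarithm of $t\ne0$ may be used). Suppose that the $2K$-fold integral below converges absolutely (a condition that does not depend on $q$ with $|q|=1$). Then the series on the left, over all pairs of partitions of length at most $K$, converges absolutely, the integrand of the contour integral is integrable on $|q|=1$, and $$\sum_{\ell(\lambda)\le K,\ \ell(\mu)\le K}\mathcal B_{\lambda,\mu}(\vec a;\sigma)\,t^{|\lambda|+|\mu|}=\frac{Q(\vec a,K,\sigma)}{t^{K(K-1)}}\,\frac{1}{(2K)!}\,\frac{1}{2\pi i}\oint_{|q|=1}\left[\int\!\cdots\!\int\prod_{1\le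 i<j\le 2K}(x_i-x_j)^2\,t^{\sum_{i=1}^{2K}x_i}\prod_{i=1}^{2K}d\nu(x_i)\right]\frac{dq}{q}.$$ -/

import Mathlib

namespace PainleveBlock

noncomputable section

/-- Barnes' `G`-function, through its Weierstrass product: with `s = z - 1`,
`G(1 + s) = (2π)^(s/2) exp(-s(s+1)/2 - γ s²/2) ∏_{k ≥ 1} (1 + s/k)^k exp(-s + s²/(2k))`. -/
def barnesG (z : ℂ) : ℂ :=
  (2 * (Real.pi : ℂ)) ^ ((z - 1) / 2) *
    Complex.exp (-(1 / 2) * (z - 1) * ((z - 1) + 1)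
      - (1 / 2) * (Real.eulerMascheroniConstant : ℂ) * (z - 1) ^ 2) *
    ∏' k : ℕ, ((1 + (z - 1) / ((k : ℂ) + 1)) ^ (k + 1) *
      Complex.exp (-(z - 1) + (z - 1) ^ 2 / (2 * ((k : ℂ) + 1))))

/-- `P(a; z) = ∏ (z + a_i)`. -/
def listP {p : ℕ} (a : Fin p → ℂ) (z : ℂ) : ℂ := ∏ i, (z + a i)

/-- `Γ(a; z) = ∏ Γ(z + a_i)`. -/
def listGamma {p : ℕ} (a : Fin p → ℂ) (z : ℂ) : ℂ := ∏ i, Complex.Gamma (z + a i)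

/-- `G(a; z) = ∏ G(z + a_i)`. -/
def listG {p : ℕ} (a : Fin p → ℂ) (z : ℂ) : ℂ := ∏ i, barnesG (z + a i)

/-- The hook length `λ_i - i + λ'_j - j + 1`, as a complex number. The box `c = (i - 1, j - 1)` is
counted from `0`, so that `λ_i = lam.rowLen c.1` and `λ'_j = lam.colLen c.2`. -/
def hook (lam : YoungDiagram) (c : ℕ × ℕ) : ℂ :=
  (lam.rowLen c.1 : ℂ) - ((c.1 : ℂ) + 1) + (lam.colLen c.2 : ℂ) - ((c.2 : ℂ) + 1) + 1

/-- The coefficient `B_{λ, μ}(a; σ)` of the Painlevé conformal block (boxes counted from `0`). -/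
def blockCoeff {p : ℕ} (a : Fin p → ℂ) (σ : ℂ) (lam mu : YoungDiagram) : ℂ :=
  (∏ c ∈ lam.cells,
    listP a (((c.1 : ℂ) + 1) - ((c.2 : ℂ) + 1) + σ) /
      (hook lam c ^ 2 *
        ((lam.colLen c.2 : ℂ) + (mu.rowLen c.1 : ℂ)
          - ((c.1 : ℂ) + 1) - ((c.2 : ℂ) + 1) + 1 + 2 * σ) ^ 2)) *
  (∏ c ∈ mu.cells,
    listP a (((c.1 : ℂ) + 1) - ((c.2 : ℂ) + 1) - σ) /
      (hook mu c ^ 2 *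
        ((lam.rowLen c.1 : ℂ) + (mu.colLen c.2 : ℂ)
          - ((c.1 : ℂ) + 1) - ((c.2 : ℂ) + 1) + 1 - 2 * σ) ^ 2))

/-- Partitions of length at most `K` (the length is the number of rows, `lam.colLen 0`). -/
abbrev ShortPartition (K : ℕ) : Type := {lam : YoungDiagram // lam.colLen 0 ≤ K}

/-- The weight `w(z) = 1 / (Γ(a; K - z) Γ(z + 1 + σ)² Γ(z + 1 - σ)²)`. At a pole of one of the gamma
factors, Mathlib's `Complex.Gamma` is `0`, hence this is `0`, the value there of the entire
function `w`. -/
def weight {p : ℕ} (a : Fin p → ℂ) (K : ℕ) (σ z : ℂ) : ℂ :=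
  1 / (listGamma a ((K : ℂ) - z) * Complex.Gamma (z + 1 + σ) ^ 2 * Complex.Gamma (z + 1 - σ) ^ 2)

/-- The prefactor `Q(a, K, σ)`. -/
def prefactor {p : ℕ} (a : Fin p → ℂ) (K : ℕ) (σ : ℂ) : ℂ :=
  listG a ((K : ℂ) + 1 + σ) * listG a ((K : ℂ) + 1 - σ) / (listG a (1 + σ) * listG a (1 - σ)) *
    Complex.Gamma (2 * σ) ^ (2 * K) * Complex.Gamma (1 - 2 * σ) ^ (2 * K)

/-- The integral `∫ f dν` against the discrete complex measure
`ν = q ∑_k w(k + σ) δ_{k + σ} + q⁻¹ ∑_k w(k - σ) δ_{k - σ}`. -/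
def nuIntegral {p : ℕ} (a : Fin p → ℂ) (K : ℕ) (σ q : ℂ) (f : ℂ → ℂ) : ℂ :=
  q * ∑' k : ℕ, weight a K σ ((k : ℂ) + σ) * f ((k : ℂ) + σ) +
    q⁻¹ * ∑' k : ℕ, weight a K σ ((k : ℂ) - σ) * f ((k : ℂ) - σ)

/-- The `n`-fold integral `∫ ⋯ ∫ f(x_1, …, x_n) dν(x_1) ⋯ dν(x_n)`. -/
def nuMultiIntegral {p : ℕ} (a : Fin p → ℂ) (K : ℕ) (σ q : ℂ) :
    (n : ℕ) → ((Fin n → ℂ) → ℂ) → ℂ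
  | 0, f => f Fin.elim0
  | n + 1, f => nuIntegral a K σ q fun x =>
      nuMultiIntegral a K σ q n fun y => f (Fin.cons x y)

/-- The atoms of `ν`: the points `k + σ` and `k - σ`, `k = 0, 1, 2, …`. -/
def nuAtom (σ : ℂ) : Bool × ℕ → ℂ
  | (true, k) => (k : ℂ) + σ
  | (false, k) => (k : ℂ) - σ

/-- The masses of the atoms of `ν`. -/
def nuMass {p : ℕ} (a : Fin p → ℂ) (K : ℕ) (σ q : ℂ) : Bool × ℕ → ℂ
  | (true, k) => q * weight a K σ ((k : ℂ) + σ)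
  | (false, k) => q⁻¹ * weight a K σ ((k : ℂ) - σ)

/-- The `n`-fold integral of `f` against `ν` converges (absolutely): the family of the values of `f`
at the points of the `n`-fold product of the lattice, each times its mass, is summable. -/
def NuMultiConverges {p : ℕ} (a : Fin p → ℂ) (K : ℕ) (σ q : ℂ) (n : ℕ)
    (f : (Fin n → ℂ) → ℂ) : Prop :=
  Summable fun s : Fin n → Bool × ℕ =>
    (∏ i, nuMass a K σ q (s i)) * f (fun i => nuAtom σ (s i))

/-- The integrand `∏_{i < j} (x_i - x_j)² t^(∑ x_i)`, where `t = exp u` and powers of `t` are taken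
with the branch `t^x = exp (u x)`. -/
def matrixIntegrand (u : ℂ) (n : ℕ) (x : Fin n → ℂ) : ℂ :=
  (∏ i, ∏ j ∈ Finset.Ioi i, (x i - x j) ^ 2) * Complex.exp (u * ∑ i, x i)

end

end PainleveBlock

open PainleveBlock

namespace PainleveBlock

theorem mem_cells_iff_lt {K : ℕ} {lam : YoungDiagram} (h : lam.colLen 0 ≤ K) (c : ℕ × ℕ) :
    c ∈ lam.cells ↔ c.1 ∈ Finset.range K ∧ c.2 ∈ Finset.range (lam.rowLen c.1) := by
  obtain ⟨i, j⟩ := c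
  simp only [YoungDiagram.mem_cells, Finset.mem_range, ← YoungDiagram.mem_iff_lt_rowLen]
  refine ⟨fun hij => ⟨lt_of_lt_of_le ?_ h, hij⟩, fun hij => hij.2⟩
  rw [← YoungDiagram.mem_iff_lt_colLen]
  exact lam.up_left_mem le_rfl (Nat.zero_le j) hij

theorem prod_cells_eq {K : ℕ} {lam : YoungDiagram} (h : lam.colLen 0 ≤ K) (f : ℕ → ℕ → ℂ) :
    ∏ c ∈ lam.cells, f c.1 c.2 = ∏ i : Fin K, ∏ j ∈ Finset.range (lam.rowLen i), f i j := by
  rw [Fin.prod_univ_eq_prod_range (fun i => ∏ j ∈ Finset.range (lam.rowLen i), f i j) K]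
  exact Finset.prod_finset_product' lam.cells _ _ (mem_cells_iff_lt h)

theorem card_eq_sum_rowLen {K : ℕ} {lam : YoungDiagram} (h : lam.colLen 0 ≤ K) :
    lam.card = ∑ i : Fin K, lam.rowLen i := by
  rw [Fin.sum_univ_eq_sum_range, YoungDiagram.card, Finset.card_eq_sum_ones,
    Finset.sum_finset_product lam.cells (Finset.range K)
      (fun i => Finset.range (lam.rowLen i)) (mem_cells_iff_lt h)]
  simp

theorem rowLen_eq_zero {K : ℕ} {lam : YoungDiagram} (h : lam.colLen 0 ≤ K) {i : ℕ} (hi : K ≤ i) :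
    lam.rowLen i = 0 := by
  by_contra h0
  have h1 : (i, 0) ∈ lam := YoungDiagram.mem_iff_lt_rowLen.2 (Nat.pos_of_ne_zero h0)
  rw [YoungDiagram.mem_iff_lt_colLen] at h1
  omega

/-- For the columns ending exactly in row `i`, the column length is `i + 1`. -/
theorem colLen_eq_succ {lam : YoungDiagram} {i j : ℕ} (h1 : lam.rowLen (i + 1) ≤ j)
    (h2 : j < lam.rowLen i) : lam.colLen j = i + 1 := by
  have h3 := YoungDiagram.mem_iff_lt_colLen.1 (YoungDiagram.mem_iff_lt_rowLen.2 h2)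
  have h4 : ¬ (i + 1 < lam.colLen j) := fun h =>
    absurd (YoungDiagram.mem_iff_lt_rowLen.1 (YoungDiagram.mem_iff_lt_colLen.2 h)) (by omega)
  omega

theorem prod_range_rowLen_step (lam : YoungDiagram) (i : ℕ) (X : ℂ) :
    ∏ j ∈ Finset.range (lam.rowLen i), (X + lam.colLen j - j) =
      (∏ j ∈ Finset.range (lam.rowLen (i + 1)), (X + lam.colLen j - j)) *
        ∏ j ∈ Finset.Ico (lam.rowLen (i + 1)) (lam.rowLen i), (X + (i + 1) - j) := by
  rw [← Finset.prod_range_mul_prod_Ico _ (lam.rowLen_anti i (i + 1) (Nat.le_succ i))]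
  congr 1
  refine Finset.prod_congr rfl fun j hj => ?_
  rw [Finset.mem_Ico] at hj
  rw [colLen_eq_succ hj.1 hj.2]
  push_cast
  ring

theorem prod_Ico_contents (X : ℂ) {K d i a b : ℕ} (hi : i + 1 + d = K) :
    ∏ j ∈ Finset.Ico a b, (X + ((i : ℂ) + 1) - j) =
      ∏ r ∈ Finset.Ico (d + a) (d + b), (X + K - r) := by
  rw [add_comm d a, add_comm d b, ← Finset.prod_Ico_add' (fun r : ℕ => X + (K : ℂ) - r) a b d]
  refine Finset.prod_congr rfl fun j _ => ?_
  rw [← hi]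
  push_cast
  ring

theorem prod_col_mul_prod_Ico {K : ℕ} {lam : YoungDiagram} (h : lam.colLen 0 ≤ K) (X : ℂ)
    (d : ℕ) : ∀ i, i + d = K →
    (∏ j ∈ Finset.range (lam.rowLen i), (X + lam.colLen j - j)) *
      ∏ k ∈ Finset.Ico i K, (X + ((k : ℂ) + 1) - lam.rowLen k) =
        ∏ r ∈ Finset.range (d + lam.rowLen i), (X + K - r) := by
  induction d with
  | zero =>
    intro i hi
    rw [rowLen_eq_zero h (show K ≤ i by omega), show i = K by omega]
    simp
  | succ d ih =>
    intro i hi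
    have hle := lam.rowLen_anti i (i + 1) (Nat.le_succ i)
    rw [prod_range_rowLen_step, Finset.prod_eq_prod_Ico_succ_bot (by omega : i < K),
      show ∀ A B C D : ℂ, A * B * (C * D) = A * D * (B * C) by intros; ring,
      ih (i + 1) (by omega), ← Finset.prod_Ico_succ_top hle (fun j : ℕ => X + ((i : ℂ) + 1) - j),
      prod_Ico_contents X (d := d) (K := K) (by omega),
      Finset.prod_range_mul_prod_Ico _ (by omega)]
    congr 2
    omega

/-- The strictly decreasing sequence `λ_i + K - i` attached to a partition with at most `K` rows
(rows counted from `0`). -/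
def shiftedRow (K : ℕ) (lam : YoungDiagram) (i : Fin K) : ℕ := lam.rowLen i + (K - 1 - i)

theorem shiftedRow_cast (K : ℕ) (lam : YoungDiagram) (i : Fin K) :
    (shiftedRow K lam i : ℂ) = lam.rowLen i + (K - 1 - i) := by
  have : (K : ℂ) = ((K - 1 - i : ℕ) : ℂ) + i + 1 := by
    exact_mod_cast (by omega : K = K - 1 - i + i + 1)
  rw [shiftedRow, this]
  push_cast
  ring

/-- The contents of row `i` of the generalized hook product: multiplied by the differences with the
later shifted rows, they fill a full falling factorial. -/
theorem prod_col_mul_prod_shiftedRow {K : ℕ} {lam : YoungDiagram} (h : lam.colLen 0 ≤ K)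
    (i : Fin K) (x : ℂ) :
    (∏ j ∈ Finset.range (lam.rowLen i), (x - K + lam.colLen j - j)) *
      ∏ k ∈ Finset.Ioi i, (x - shiftedRow K lam k) =
        ∏ r ∈ Finset.range (shiftedRow K lam i), (x - r) := by
  obtain ⟨i, hi⟩ := i
  have hle := lam.rowLen_anti i (i + 1) (Nat.le_succ i)
  have e : ∏ k ∈ Finset.Ioi (⟨i, hi⟩ : Fin K), (x - shiftedRow K lam k) =
      ∏ k ∈ Finset.Ico (i + 1) K, (x - K + ((k : ℂ) + 1) - lam.rowLen k) := by
    have e' : Finset.Ico (i + 1) K = (Finset.Ioi (⟨i, hi⟩ : Fin K)).map Fin.valEmbedding := by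
      ext k
      simp only [Finset.mem_Ico, Finset.mem_map, Finset.mem_Ioi, Fin.valEmbedding_apply]
      exact ⟨fun hk => ⟨⟨k, hk.2⟩, hk.1, rfl⟩, fun ⟨m, hm, hmk⟩ => by
        have : i < m := hm; omega⟩
    rw [e', Finset.prod_map]
    refine Finset.prod_congr rfl fun k _ => ?_
    rw [shiftedRow_cast, Fin.valEmbedding_apply]
    ring
  rw [e, Fin.val_mk, prod_range_rowLen_step, mul_right_comm,
    prod_col_mul_prod_Ico h _ (K - 1 - i) (i + 1) (by omega),
    prod_Ico_contents _ (d := K - 1 - i) (K := K) (by omega), Finset.prod_range_mul_prod_Ico _ (by omega)]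
  simp only [sub_add_cancel, shiftedRow, add_comm (lam.rowLen i)]

theorem prod_range_mul_inv_Gamma (y : ℂ) (n : ℕ) :
    (∏ r ∈ Finset.range n, (y - 1 - r)) * (Complex.Gamma y)⁻¹ = (Complex.Gamma (y - n))⁻¹ := by
  induction n with
  | zero => simp
  | succ n ih =>
    rw [Finset.prod_range_succ, mul_right_comm, ih,
      Complex.one_div_Gamma_eq_self_mul_one_div_Gamma_add_one (y - (n + 1 : ℕ))]
    push_cast
    rw [show y - (n + 1) + 1 = y - n by ring]
    ring

theorem hook_prod {K : ℕ} {lam : YoungDiagram} (h : lam.colLen 0 ≤ K) (i : Fin K) :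
    (∏ j ∈ Finset.range (lam.rowLen i), hook lam (i, j)) *
      ∏ k ∈ Finset.Ioi i, ((shiftedRow K lam i : ℂ) - shiftedRow K lam k) =
        Complex.Gamma ((shiftedRow K lam i : ℂ) + 1) := by
  have h1 := prod_col_mul_prod_shiftedRow h i (shiftedRow K lam i : ℂ)
  have h2 : ∏ r ∈ Finset.range (shiftedRow K lam i), ((shiftedRow K lam i : ℂ) - r) =
      Complex.Gamma ((shiftedRow K lam i : ℂ) + 1) := by
    have := prod_range_mul_inv_Gamma ((shiftedRow K lam i : ℂ) + 1) (shiftedRow K lam i)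
    simp only [add_sub_cancel_right, add_sub_cancel_left, Complex.Gamma_one, inv_one] at this
    rwa [mul_inv_eq_one₀] at this
    rw [Complex.Gamma_nat_eq_factorial]
    exact_mod_cast Nat.factorial_ne_zero _
  rw [← h2, ← h1]
  congr 1
  refine Finset.prod_congr rfl fun j _ => ?_
  rw [hook, shiftedRow_cast]
  ring

theorem cross_prod {K : ℕ} {lam : YoungDiagram} (mu : YoungDiagram) (h : lam.colLen 0 ≤ K)
    (i : Fin K) (z : ℂ) :
    (∏ j ∈ Finset.range (lam.rowLen i), ((lam.colLen j : ℂ) + (mu.rowLen i : ℂ)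
          - ((i : ℂ) + 1) - ((j : ℂ) + 1) + 1 + z)) *
      (∏ k ∈ Finset.Ioi i, ((shiftedRow K mu i : ℂ) + z - shiftedRow K lam k)) *
      (Complex.Gamma ((shiftedRow K mu i : ℂ) + 1 + z))⁻¹ =
        (Complex.Gamma ((shiftedRow K mu i : ℂ) + 1 + z - shiftedRow K lam i))⁻¹ := by
  rw [← prod_range_mul_inv_Gamma, ← (prod_col_mul_prod_shiftedRow h i _).trans
    (Finset.prod_congr rfl fun r _ => by rw [show ((shiftedRow K mu i : ℂ) + z - r) =
      (shiftedRow K mu i : ℂ) + 1 + z - 1 - r by ring])]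
  congr 2
  refine Finset.prod_congr rfl fun j _ => ?_
  rw [shiftedRow_cast]
  ring

theorem listP_prod {p : ℕ} (a : Fin p → ℂ) {K : ℕ} (lam : YoungDiagram) (i : Fin K) (s : ℂ)
    (ha : ∀ (l : Fin p) (n : ℕ), a l + s ≠ -((n : ℂ) + 1)) :
    ∏ j ∈ Finset.range (lam.rowLen i), listP a (((i : ℂ) + 1) - ((j : ℂ) + 1) + s) =
      listGamma a ((i : ℂ) + 1 + s) * (listGamma a ((K : ℂ) - (shiftedRow K lam i - s)))⁻¹ := by
  simp only [listP, listGamma]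
  rw [Finset.prod_comm, ← Finset.prod_inv_distrib, ← Finset.prod_mul_distrib]
  refine Finset.prod_congr rfl fun l _ => ?_
  have h0 : Complex.Gamma ((i : ℂ) + 1 + s + a l) ≠ 0 := by
    refine Complex.Gamma_ne_zero fun m hm => ha l (i + m) ?_
    push_cast
    linear_combination hm
  have := prod_range_mul_inv_Gamma ((i : ℂ) + 1 + s + a l) (lam.rowLen i)
  rw [shiftedRow_cast, show (K : ℂ) - ((lam.rowLen i : ℂ) + (K - 1 - i) - s) + a l =
    (i : ℂ) + 1 + s + a l - lam.rowLen i by ring, ← this, mul_comm _ (Complex.Gamma _)⁻¹,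
    mul_inv_cancel_left₀ h0]
  refine Finset.prod_congr rfl fun j _ => ?_
  ring

theorem Gamma_reflection_sq (z : ℂ) (hz : ∀ n : ℤ, z ≠ n) (n : ℤ) :
    (Complex.Gamma (1 + (z + n)) * Complex.Gamma (1 - (z + n))) ^ 2 =
      (z + n) ^ 2 * (Complex.Gamma z * Complex.Gamma (1 - z)) ^ 2 := by
  have h0 : z + n ≠ 0 := fun h => hz (-n) (by push_cast; linear_combination h)
  rw [add_comm 1, Complex.Gamma_add_one _ h0, mul_assoc, Complex.Gamma_mul_Gamma_one_sub,
    Complex.Gamma_mul_Gamma_one_sub, mul_pow, div_pow, div_pow]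
  congr 2
  rw [show (Real.pi : ℂ) * (z + n) = Real.pi * z + n * Real.pi by ring, Complex.sin_sq, Complex.sin_sq,
    Complex.cos_sq, Complex.cos_sq, mul_add, show (2 : ℂ) * (n * Real.pi) = n * (2 * Real.pi) by ring,
    Complex.cos_add_int_mul_two_pi]

theorem weight_add {p : ℕ} (a : Fin p → ℂ) (K : ℕ) (σ x : ℂ) :
    weight a K σ (x + σ) = (listGamma a ((K : ℂ) - (x + σ)))⁻¹ *
      (Complex.Gamma (x + 1 + 2 * σ) ^ 2)⁻¹ * (Complex.Gamma (x + 1) ^ 2)⁻¹ := by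
  rw [weight, one_div, mul_inv, mul_inv, show x + σ + 1 + σ = x + 1 + 2 * σ by ring,
    show x + σ + 1 - σ = x + 1 by ring]

theorem weight_sub {p : ℕ} (a : Fin p → ℂ) (K : ℕ) (σ x : ℂ) :
    weight a K σ (x - σ) = (listGamma a ((K : ℂ) - (x - σ)))⁻¹ *
      (Complex.Gamma (x + 1) ^ 2)⁻¹ * (Complex.Gamma (x + 1 + -(2 * σ)) ^ 2)⁻¹ := by
  rw [weight, one_div, mul_inv, mul_inv, show x - σ + 1 - σ = x + 1 + -(2 * σ) by ring,
    show x - σ + 1 + σ = x + 1 by ring]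

theorem prod_prod_eq_diag_mul {n : ℕ} (f : Fin n → Fin n → ℂ) :
    ∏ i, ∏ j, f i j = ∏ i, f i i * ∏ j ∈ Finset.Ioi i, f i j * f j i := by
  rw [Finset.prod_mul_distrib]
  rw [Finset.prod_prod_Ioi_mul_eq_prod_prod_off_diag (fun i j => f j i),
    ← Finset.prod_mul_distrib]
  refine Finset.prod_congr rfl fun i _ => ?_
  rw [Fintype.prod_eq_mul_prod_compl i]

theorem row_algebra {H₁ V₁ H₂ V₂ C₁ D₁ C₂ D₂ G₁ G₂ g₁ g₂ g₃ g₄ p₁ q₁ p₂ q₂ y S : ℂ}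
    (h₁ : H₁ * V₁ = G₁) (h₂ : H₂ * V₂ = G₂) (c₁ : C₁ * D₁ * g₁⁻¹ = g₃⁻¹)
    (c₂ : C₂ * D₂ * g₂⁻¹ = g₄⁻¹) (hS : (g₃ * g₄) ^ 2 = y ^ 2 * S ^ 2)
    (hG₁ : G₁ ≠ 0) (hG₂ : G₂ ≠ 0) (hg₁ : g₁ ≠ 0) (hg₂ : g₂ ≠ 0) (hg₃ : g₃ ≠ 0) (hg₄ : g₄ ≠ 0) :
    p₁ * q₁ / (H₁ ^ 2 * C₁ ^ 2) * (p₂ * q₂ / (H₂ ^ 2 * C₂ ^ 2)) =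
      p₁ * p₂ * S ^ 2 * (q₂ * (g₁ ^ 2)⁻¹ * (G₂ ^ 2)⁻¹ * (q₁ * (G₁ ^ 2)⁻¹ * (g₂ ^ 2)⁻¹)) *
        (V₂ ^ 2 * V₁ ^ 2 * (y ^ 2 * (D₁ ^ 2 * D₂ ^ 2))) := by
  have e₁ : g₁ = C₁ * D₁ * g₃ := by field_simp at c₁; exact c₁.symm
  have e₂ : g₂ = C₂ * D₂ * g₄ := by field_simp at c₂; exact c₂.symm
  subst h₁ h₂
  rw [e₁] at hg₁
  rw [e₂] at hg₂
  simp only [mul_ne_zero_iff] at hG₁ hG₂ hg₁ hg₂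
  obtain ⟨⟨a₁, b₁⟩, -⟩ := hg₁
  obtain ⟨⟨a₂, b₂⟩, -⟩ := hg₂
  obtain ⟨a₃, b₃⟩ := hG₁
  obtain ⟨a₄, b₄⟩ := hG₂
  rw [show ∀ A B C D : ℂ, p₁ * p₂ * S ^ 2 * A * (B * C * (y ^ 2 * D)) =
    p₁ * p₂ * (y ^ 2 * S ^ 2) * A * (B * C * D) by intros; ring, ← hS, e₁, e₂]
  field_simp

/-- The contribution of the `i`-th rows of both partitions to `blockCoeff`. -/
theorem row_coeff_eq {p : ℕ} (a : Fin p → ℂ) {K : ℕ} {σ : ℂ} (hσ : ∀ n : ℤ, 2 * σ ≠ (n : ℂ))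
    (ha : ∀ (i : Fin p) (n : ℕ), a i + σ ≠ -((n : ℂ) + 1) ∧ a i - σ ≠ -((n : ℂ) + 1))
    {lam mu : YoungDiagram} (hl : lam.colLen 0 ≤ K) (hm : mu.colLen 0 ≤ K) (i : Fin K) :
    (∏ j ∈ Finset.range (lam.rowLen i), listP a (((i : ℂ) + 1) - ((j : ℂ) + 1) + σ) /
      (hook lam (i, j) ^ 2 * ((lam.colLen j : ℂ) + (mu.rowLen i : ℂ)
          - ((i : ℂ) + 1) - ((j : ℂ) + 1) + 1 + 2 * σ) ^ 2)) *
    (∏ j ∈ Finset.range (mu.rowLen i), listP a (((i : ℂ) + 1) - ((j : ℂ) + 1) - σ) /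
      (hook mu (i, j) ^ 2 * ((lam.rowLen i : ℂ) + (mu.colLen j : ℂ)
          - ((i : ℂ) + 1) - ((j : ℂ) + 1) + 1 - 2 * σ) ^ 2)) =
    (listGamma a ((i : ℂ) + 1 + σ) * listGamma a ((i : ℂ) + 1 - σ)) *
      (Complex.Gamma (2 * σ) * Complex.Gamma (1 - 2 * σ)) ^ 2 *
      (weight a K σ (shiftedRow K mu i + σ) * weight a K σ (shiftedRow K lam i - σ)) *
      ((∏ k ∈ Finset.Ioi i, ((shiftedRow K mu i : ℂ) - shiftedRow K mu k) ^ 2) *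
        (∏ k ∈ Finset.Ioi i, ((shiftedRow K lam i : ℂ) - shiftedRow K lam k) ^ 2) *
        (((shiftedRow K mu i : ℂ) + σ - (shiftedRow K lam i - σ)) ^ 2 *
          ∏ k ∈ Finset.Ioi i, ((shiftedRow K mu i : ℂ) + σ - (shiftedRow K lam k - σ)) ^ 2 *
            ((shiftedRow K mu k : ℂ) + σ - (shiftedRow K lam i - σ)) ^ 2)) := by
  have hG : ∀ (m : ℤ), Complex.Gamma (m + 2 * σ) ≠ 0 ∧ Complex.Gamma (m + -(2 * σ)) ≠ 0 :=
    fun m => ⟨Complex.Gamma_ne_zero fun n h => hσ (-n - m) (by push_cast; linear_combination h),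
      Complex.Gamma_ne_zero fun n h => hσ (n + m) (by push_cast; linear_combination -h)⟩
  have hN : ∀ n : ℕ, Complex.Gamma ((n : ℂ) + 1) ≠ 0 := fun n => by
    rw [Complex.Gamma_nat_eq_factorial]
    exact_mod_cast n.factorial_ne_zero
  have H1 := hook_prod hl i
  have H2 := hook_prod hm i
  have C1 := cross_prod mu hl i (2 * σ)
  have C2 := cross_prod lam hm i (-(2 * σ))
  have P1 := listP_prod a lam i σ fun l n => (ha l n).1
  have P2 := listP_prod a mu i (-σ) fun l n => (ha l n).2
  have R := Gamma_reflection_sq (2 * σ) hσ ((shiftedRow K mu i : ℤ) - shiftedRow K lam i)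
  have h1 := hN (shiftedRow K lam i)
  have h2 := hN (shiftedRow K mu i)
  have g1 := (hG (shiftedRow K mu i + 1)).1
  have g2 := (hG (shiftedRow K lam i + 1)).2
  have g3 := (hG (shiftedRow K mu i + 1 - shiftedRow K lam i)).1
  have g4 := (hG (shiftedRow K lam i + 1 - shiftedRow K mu i)).2
  push_cast at g1 g2 g3 g4 R
  have A := row_algebra (p₁ := listGamma a ((i : ℂ) + 1 + σ)) (p₂ := listGamma a ((i : ℂ) + 1 + -σ))
    (q₁ := (listGamma a ((K : ℂ) - (shiftedRow K lam i - σ)))⁻¹)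
    (q₂ := (listGamma a ((K : ℂ) - (shiftedRow K mu i - -σ)))⁻¹) H1 H2 C1 C2 (S := _) (y := _)
    (by rw [← R]; congr 3 <;> ring) h1 h2 (by convert g1 using 1) (by convert g2 using 1)
    (by convert g3 using 2; ring) (by convert g4 using 2; ring)
  rw [← P1, ← P2] at A
  simp only [← Finset.prod_mul_distrib, ← Finset.prod_div_distrib, ← Finset.prod_pow] at A
  rw [weight_add, weight_sub]
  convert A using 2
  · refine Finset.prod_congr rfl fun j _ => ?_
    rw [sub_eq_add_neg _ σ, sub_eq_add_neg _ (2 * σ), add_comm (lam.rowLen i : ℂ)]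
  · simp only [sub_neg_eq_add, ← sub_eq_add_neg]
  · rw [← Finset.prod_mul_distrib]
    congr 2
    · ring
    · refine Finset.prod_congr rfl fun j _ => ?_
      ring

/-- The coefficient of the block in the coordinates of the particles `μ_i + K - i + σ` and
`λ_i + K - i - σ`. -/
theorem blockCoeff_eq {p : ℕ} (a : Fin p → ℂ) {K : ℕ} {σ : ℂ} (hσ : ∀ n : ℤ, 2 * σ ≠ (n : ℂ))
    (ha : ∀ (i : Fin p) (n : ℕ), a i + σ ≠ -((n : ℂ) + 1) ∧ a i - σ ≠ -((n : ℂ) + 1))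
    {lam mu : YoungDiagram} (hl : lam.colLen 0 ≤ K) (hm : mu.colLen 0 ≤ K) :
    blockCoeff a σ lam mu =
    (∏ i : Fin K, listGamma a ((i : ℂ) + 1 + σ) * listGamma a ((i : ℂ) + 1 - σ)) *
      (Complex.Gamma (2 * σ) * Complex.Gamma (1 - 2 * σ)) ^ (2 * K) *
      ((∏ i : Fin K, weight a K σ (shiftedRow K mu i + σ)) *
        ∏ i : Fin K, weight a K σ (shiftedRow K lam i - σ)) *
      ((∏ i : Fin K, ∏ k ∈ Finset.Ioi i, ((shiftedRow K mu i : ℂ) - shiftedRow K mu k) ^ 2) *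
        (∏ i : Fin K, ∏ k ∈ Finset.Ioi i, ((shiftedRow K lam i : ℂ) - shiftedRow K lam k) ^ 2) *
        ∏ i : Fin K, ∏ j : Fin K,
          ((shiftedRow K mu i : ℂ) + σ - (shiftedRow K lam j - σ)) ^ 2) := by
  rw [prod_prod_eq_diag_mul]
  simp only [blockCoeff]
  rw [prod_cells_eq hl (fun i j => listP a (((i : ℂ) + 1) - ((j : ℂ) + 1) + σ) /
      (hook lam (i, j) ^ 2 * ((lam.colLen j : ℂ) + (mu.rowLen i : ℂ)
          - ((i : ℂ) + 1) - ((j : ℂ) + 1) + 1 + 2 * σ) ^ 2)),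
    prod_cells_eq hm (fun i j => listP a (((i : ℂ) + 1) - ((j : ℂ) + 1) - σ) /
      (hook mu (i, j) ^ 2 * ((lam.rowLen i : ℂ) + (mu.colLen j : ℂ)
          - ((i : ℂ) + 1) - ((j : ℂ) + 1) + 1 - 2 * σ) ^ 2)),
    ← Finset.prod_mul_distrib, Finset.prod_congr rfl fun i _ => row_coeff_eq a hσ ha hl hm i]
  simp only [Finset.prod_mul_distrib, Finset.prod_const, Finset.card_univ, Fintype.card_fin, pow_mul]

section Barnes

open Filter Topology

noncomputable section

/-- The factors of the Weierstrass product of `G(1 + s)`. -/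
def barnesFactor (s : ℂ) (k : ℕ) : ℂ :=
  (1 + s / ((k : ℂ) + 1)) ^ (k + 1) * Complex.exp (-s + s ^ 2 / (2 * ((k : ℂ) + 1)))

end

theorem norm_barnesFactor_sub_one_le (s : ℂ) (k : ℕ) (h₁ : 2 * ‖s‖ ≤ k + 1)
    (h₂ : ‖s‖ ^ 3 ≤ k + 1) : ‖barnesFactor s k - 1‖ ≤ 2 * ‖s‖ ^ 3 * (1 / ((k : ℝ) + 1) ^ 2) := by
  have hk : (0 : ℝ) < k + 1 := by positivity
  have hk' : (k : ℂ) + 1 ≠ 0 := Nat.cast_add_one_ne_zero k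
  set x : ℂ := s / ((k : ℂ) + 1) with hx
  have hnk : ‖(k : ℂ) + 1‖ = k + 1 := by
    rw [← Nat.cast_succ, Complex.norm_natCast, Nat.cast_succ]
  have hnx : ‖x‖ = ‖s‖ / (k + 1) := by rw [hx, norm_div, hnk]
  have hx1 : ‖x‖ ≤ 1 / 2 := by
    rw [hnx, div_le_iff₀ hk]
    linarith
  have hx0 : 1 + x ≠ 0 := fun h => by
    have : x = -1 := by linear_combination h
    rw [this] at hx1
    norm_num at hx1
  set w : ℂ := (k + 1) * (Complex.log (1 + x) - (x - x ^ 2 / 2)) with hw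
  have hs : s = (k + 1) * x := by rw [hx]; field_simp
  have e : barnesFactor s k = Complex.exp w := by
    have e0 : (1 + x) ^ (k + 1) = Complex.exp ((k + 1) * Complex.log (1 + x)) := by
      rw [← Nat.cast_succ, Complex.exp_nat_mul, Complex.exp_log hx0]
    rw [barnesFactor, ← hx, e0, ← Complex.exp_add, hw]
    congr 1
    nth_rw 1 2 [hs]
    field_simp
    ring
  have hw1 : ‖w‖ ≤ ‖s‖ ^ 3 * (1 / ((k : ℝ) + 1) ^ 2) := by
    have := Complex.norm_log_sub_logTaylor_le 2 (z := x) (by linarith)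
    have ht : Complex.logTaylor 3 x = x - x ^ 2 / 2 := by
      simp [Complex.logTaylor_succ, Complex.logTaylor_zero]
      ring
    rw [ht] at this
    have h3 : (1 - ‖x‖)⁻¹ ≤ 2 := by
      rw [inv_le_comm₀ (by linarith) (by norm_num)]
      linarith
    have h4 : ‖x‖ ^ 3 * (1 - ‖x‖)⁻¹ / ((2 : ℕ) + 1 : ℝ) ≤ ‖x‖ ^ 3 := by
      have : 0 ≤ ‖x‖ ^ 3 := by positivity
      push_cast
      nlinarith
    rw [hw, norm_mul, hnk]
    calc (k + 1 : ℝ) * _ ≤ (k + 1) * ‖x‖ ^ 3 := by gcongr; exact this.trans h4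
      _ = _ := by rw [hnx]; field_simp
  have hw2 : ‖w‖ ≤ 1 := by
    refine hw1.trans ?_
    rw [mul_one_div, div_le_one (by positivity)]
    nlinarith
  rw [e, mul_assoc]
  exact (Complex.norm_exp_sub_one_le hw2).trans (by gcongr)

theorem summable_norm_barnesFactor_sub_one (s : ℂ) :
    Summable fun k => ‖barnesFactor s k - 1‖ := by
  have h0 : Summable fun k : ℕ => 2 * ‖s‖ ^ 3 * (1 / ((k : ℝ) + 1) ^ 2) := by
    refine Summable.mul_left _ ?_
    exact_mod_cast (summable_nat_add_iff 1).2 (Real.summable_one_div_nat_pow.2 one_lt_two)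
  refine h0.of_norm_bounded_eventually_nat ?_
  have h : Tendsto (fun k : ℕ => (k : ℝ) + 1) atTop atTop :=
    tendsto_natCast_atTop_atTop.atTop_add tendsto_const_nhds
  filter_upwards [h.eventually_ge_atTop (2 * ‖s‖), h.eventually_ge_atTop (‖s‖ ^ 3)] with k h1 h2
  rw [norm_norm]
  exact norm_barnesFactor_sub_one_le s k h1 h2

theorem multipliable_barnesFactor (s : ℂ) : Multipliable (barnesFactor s) := by
  simpa using multipliable_one_add_of_summable (summable_norm_barnesFactor_sub_one s)

theorem tprod_barnesFactor_ne_zero {s : ℂ} (hs : ∀ n : ℕ, s + 1 ≠ -n) :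
    ∏' k, barnesFactor s k ≠ 0 := by
  have := tprod_one_add_ne_zero_of_summable (f := fun k => barnesFactor s k - 1) (fun k h => ?_)
    (summable_norm_barnesFactor_sub_one s)
  · simpa using this
  · rw [add_sub_cancel, barnesFactor, mul_eq_zero, or_iff_left (Complex.exp_ne_zero _)] at h
    have h1 := eq_zero_of_pow_eq_zero h
    have hk' : (k : ℂ) + 1 ≠ 0 := Nat.cast_add_one_ne_zero k
    field_simp at h1
    exact hs k (by linear_combination h1)

theorem barnesG_eq (z : ℂ) : barnesG z = (2 * (Real.pi : ℂ)) ^ ((z - 1) / 2) *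
    Complex.exp (-(1 / 2) * (z - 1) * ((z - 1) + 1)
      - (1 / 2) * (Real.eulerMascheroniConstant : ℂ) * (z - 1) ^ 2) *
    ∏' k : ℕ, barnesFactor (z - 1) k := rfl

theorem barnesG_ne_zero {z : ℂ} (hz : ∀ n : ℕ, z ≠ -n) : barnesG z ≠ 0 := by
  rw [barnesG_eq]
  refine mul_ne_zero (mul_ne_zero ?_ (Complex.exp_ne_zero _)) (tprod_barnesFactor_ne_zero ?_)
  · rw [Complex.cpow_ne_zero_iff]
    left
    simp [Real.pi_ne_zero]
  · simpa using hz

theorem prod_barnesFactor_add_one (s : ℂ) (N : ℕ) :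
    (∏ k ∈ Finset.range N, barnesFactor (s + 1) k) * ∏ j ∈ Finset.range N, (s + 1 + j) =
      (∏ k ∈ Finset.range N, barnesFactor s k) * ((N : ℂ) + 1 + s) ^ N *
        Complex.exp (-N + (s + 1 / 2) * (harmonic N : ℚ)) := by
  induction N with
  | zero => simp
  | succ n ih =>
    have hn : (n : ℂ) + 1 ≠ 0 := Nat.cast_add_one_ne_zero n
    rw [Finset.prod_range_succ, Finset.prod_range_succ, Finset.prod_range_succ, mul_mul_mul_comm, ih,
      harmonic_succ]
    have e1 : barnesFactor (s + 1) n = ((n : ℂ) + 1 + 1 + s) ^ (n + 1) / ((n : ℂ) + 1) ^ (n + 1) *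
        Complex.exp (-(s + 1) + (s + 1) ^ 2 / (2 * ((n : ℂ) + 1))) := by
      rw [barnesFactor, ← div_pow]
      congr 2
      field_simp
      ring
    have e2 : barnesFactor s n = ((n : ℂ) + 1 + s) ^ (n + 1) / ((n : ℂ) + 1) ^ (n + 1) *
        Complex.exp (-s + s ^ 2 / (2 * ((n : ℂ) + 1))) := by
      rw [barnesFactor, ← div_pow]
      congr 2
      field_simp
    have e3 : Complex.exp (-n + (s + 1 / 2) * (harmonic n : ℚ)) *
        Complex.exp (-(s + 1) + (s + 1) ^ 2 / (2 * ((n : ℂ) + 1))) =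
        Complex.exp (-s + s ^ 2 / (2 * ((n : ℂ) + 1))) *
        Complex.exp (-((n + 1 : ℕ) : ℂ) +
          (s + 1 / 2) * ((harmonic n + ((n + 1 : ℕ) : ℚ)⁻¹ : ℚ) : ℂ)) := by
      rw [← Complex.exp_add, ← Complex.exp_add]
      congr 1
      push_cast
      field_simp
      ring
    rw [e1, e2]
    push_cast at e3 ⊢
    linear_combination (∏ k ∈ Finset.range n, barnesFactor s k) * ((n : ℂ) + 1 + s) ^ (n + 1) *
      ((n : ℂ) + 1 + 1 + s) ^ (n + 1) / ((n : ℂ) + 1) ^ (n + 1) * e3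

theorem tendsto_barnes_ratio (s : ℂ) :
    Tendsto (fun N : ℕ => ((N : ℂ) + 1 + s) ^ (N + 1) *
        Complex.exp (-N + (s + 1 / 2) * (harmonic N : ℚ)) / ((N : ℂ) ^ (s + 1) * N.factorial)) atTop
      (𝓝 (Complex.exp (s + 1) * Complex.exp ((s + 1 / 2) * Real.eulerMascheroniConstant) /
        (Real.sqrt (2 * Real.pi) : ℝ))) := by
  have h1 := Complex.tendsto_one_add_div_pow_exp (s + 1)
  have h2 : Tendsto (fun N : ℕ => 1 + (s + 1) / (N : ℂ)) atTop (𝓝 1) := by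
    simpa using (tendsto_const_div_atTop_nhds_zero_nat (s + 1)).const_add 1
  have h3 : Tendsto (fun N : ℕ => Complex.exp ((s + 1 / 2) *
      ((harmonic N - Real.log N : ℝ) : ℂ))) atTop
      (𝓝 (Complex.exp ((s + 1 / 2) * Real.eulerMascheroniConstant))) :=
    (Complex.continuous_exp.tendsto _).comp
      (((Complex.continuous_ofReal.tendsto _).comp Real.tendsto_harmonic_sub_log).const_mul _)
  have h4 : Tendsto (fun N : ℕ => ((Real.sqrt 2 * Stirling.stirlingSeq N : ℝ) : ℂ)) atTop
      (𝓝 ((Real.sqrt (2 * Real.pi) : ℝ) : ℂ)) := by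
    rw [Real.sqrt_mul zero_le_two]
    exact (Complex.continuous_ofReal.tendsto _).comp
      (Stirling.tendsto_stirlingSeq_sqrt_pi.const_mul _)
  have h5 : ((Real.sqrt (2 * Real.pi) : ℝ) : ℂ) ≠ 0 := by
    exact_mod_cast (Real.sqrt_pos.2 (by positivity)).ne'
  have h := (((h1.mul h2).mul h3).div h4 h5)
  rw [mul_one] at h
  refine h.congr' ?_
  filter_upwards [eventually_gt_atTop 0] with N hN
  have hN' : (N : ℂ) ≠ 0 := by exact_mod_cast hN.ne'
  have hNr : (0 : ℝ) < N := by exact_mod_cast hN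
  have hs2 : ((Real.sqrt N : ℝ) : ℂ) * (Real.sqrt N : ℝ) = N := by
    exact_mod_cast Real.mul_self_sqrt hNr.le
  have e1 : ((N : ℂ) + 1 + s) ^ (N + 1) =
      (N : ℂ) ^ N * ((Real.sqrt N : ℝ) * (Real.sqrt N : ℝ)) * ((1 + (s + 1) / N) ^ N * (1 + (s + 1) / N)) := by
    rw [hs2, ← pow_succ, ← pow_succ, ← mul_pow]
    congr 1
    field_simp
    ring
  have hsq : Complex.exp ((1 / 2) * (Real.log N : ℝ)) = (Real.sqrt N : ℝ) := by
    rw [Real.sqrt_eq_rpow, Real.rpow_def_of_pos hNr]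
    push_cast
    ring_nf
  have hs0 : ((Real.sqrt N : ℝ) : ℂ) ≠ 0 := by
    exact_mod_cast (Real.sqrt_pos.2 hNr).ne'
  have e2 : (N : ℂ) ^ (s + 1) = Complex.exp ((s + 1 / 2) * (Real.log N : ℝ)) * (Real.sqrt N : ℝ) := by
    rw [Complex.cpow_def_of_ne_zero hN', ← hsq, ← Complex.exp_add, Complex.natCast_log]
    congr 1
    ring
  have e3 : Complex.exp (-N + (s + 1 / 2) * (harmonic N : ℚ)) =
      Complex.exp ((s + 1 / 2) * ((harmonic N - Real.log N : ℝ) : ℂ)) *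
        Complex.exp ((s + 1 / 2) * (Real.log N : ℝ)) * (Complex.exp 1 ^ N)⁻¹ := by
    rw [← Complex.exp_nat_mul, ← Complex.exp_neg, ← Complex.exp_add, ← Complex.exp_add]
    congr 1
    push_cast
    ring
  have e4 : (N.factorial : ℂ) = ((Real.sqrt 2 * Stirling.stirlingSeq N : ℝ) : ℂ) *
      (Real.sqrt N : ℝ) * ((N : ℂ) ^ N * (Complex.exp 1 ^ N)⁻¹) := by
    have : (N.factorial : ℝ) = Real.sqrt 2 * Stirling.stirlingSeq N * Real.sqrt N *
        ((N : ℝ) ^ N * (Real.exp 1 ^ N)⁻¹) := by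
      rw [Stirling.stirlingSeq, Real.sqrt_mul zero_le_two, div_pow]
      have := Real.sqrt_pos.2 hNr
      have := Real.sqrt_pos.2 (zero_lt_two (α := ℝ))
      have := Real.exp_pos 1
      field_simp
    have h' := congrArg (Complex.ofReal) this
    push_cast at h' ⊢
    exact h'
  have hst : ((Real.sqrt 2 * Stirling.stirlingSeq N : ℝ) : ℂ) ≠ 0 := fun h0 => by
    rw [h0] at e4
    simp [N.factorial_ne_zero] at e4
  have hx1 := Complex.exp_ne_zero ((s + 1 / 2) * (Real.log N : ℝ))
  have hx2 := Complex.exp_ne_zero 1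
  rw [e1, e2, e3, e4, Pi.div_apply]
  generalize ((Real.sqrt 2 * Stirling.stirlingSeq N : ℝ) : ℂ) = S at *
  generalize Complex.exp ((s + 1 / 2) * (Real.log N : ℝ)) = E at *
  generalize Complex.exp ((s + 1 / 2) * ((harmonic N - Real.log N : ℝ) : ℂ)) = B at *
  generalize (1 + (s + 1) / (N : ℂ)) = A at *
  field_simp

/-- The functional equation of Barnes' `G`-function, away from the poles of `Γ`. -/
theorem barnesG_add_one {z : ℂ} (hz : ∀ n : ℕ, z ≠ -n) :
    barnesG (z + 1) = Complex.Gamma z * barnesG z := by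
  obtain ⟨s, rfl⟩ : ∃ s, z = s + 1 := ⟨z - 1, by ring⟩
  have hne : ∀ j : ℕ, s + 1 + j ≠ 0 := fun j h => hz j (by linear_combination h)
  have l1 := (multipliable_barnesFactor (s + 1)).hasProd.tendsto_prod_nat
  have l2 := ((multipliable_barnesFactor s).hasProd.tendsto_prod_nat.mul
    (Complex.GammaSeq_tendsto_Gamma (s + 1))).mul (tendsto_barnes_ratio s)
  have key := tendsto_nhds_unique l1 (l2.congr' ?_)
  · rw [barnesG_eq, barnesG_eq, add_sub_cancel_right, add_sub_cancel_right, key]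
    have hp : (2 * (Real.pi : ℂ)) ≠ 0 := by simp [Real.pi_ne_zero]
    have e1 : (2 * (Real.pi : ℂ)) ^ ((s + 1) / 2) =
        (2 * (Real.pi : ℂ)) ^ (s / 2) * (Real.sqrt (2 * Real.pi) : ℝ) := by
      rw [add_div, Complex.cpow_add _ _ hp, Real.sqrt_eq_rpow, Complex.ofReal_cpow (by positivity)]
      push_cast
      rfl
    have e2 : Complex.exp (-(1 / 2) * (s + 1) * ((s + 1) + 1)
        - (1 / 2) * (Real.eulerMascheroniConstant : ℂ) * (s + 1) ^ 2) *
        (Complex.exp (s + 1) * Complex.exp ((s + 1 / 2) * Real.eulerMascheroniConstant)) =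
        Complex.exp (-(1 / 2) * s * (s + 1)
        - (1 / 2) * (Real.eulerMascheroniConstant : ℂ) * s ^ 2) := by
      rw [← Complex.exp_add, ← Complex.exp_add]
      congr 1
      ring
    have h5 : ((Real.sqrt (2 * Real.pi) : ℝ) : ℂ) ≠ 0 := by
      exact_mod_cast (Real.sqrt_pos.2 (by positivity)).ne'
    rw [e1, ← e2]
    field_simp
  · filter_upwards [eventually_gt_atTop 0] with N hN
    have h := prod_barnesFactor_add_one s N
    have hP : ∏ j ∈ Finset.range N, (s + 1 + j) ≠ 0 := Finset.prod_ne_zero_iff.2 fun j _ => hne j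
    have hN' : (N : ℂ) ≠ 0 := by exact_mod_cast hN.ne'
    have hc : (N : ℂ) ^ (s + 1) ≠ 0 := by simp [Complex.cpow_eq_zero_iff, hN']
    have hf : (N.factorial : ℂ) ≠ 0 := by exact_mod_cast N.factorial_ne_zero
    have hs := hne N
    rw [← eq_div_iff hP] at h
    rw [h, Complex.GammaSeq, Finset.prod_range_succ]
    field_simp
    ring

theorem listG_add_natCast {p : ℕ} (a : Fin p → ℂ) (s : ℂ)
    (ha : ∀ (l : Fin p) (n : ℕ), a l + s ≠ -((n : ℂ) + 1)) (K : ℕ) :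
    listG a ((K : ℂ) + 1 + s) = (∏ i : Fin K, listGamma a ((i : ℂ) + 1 + s)) * listG a (1 + s) := by
  rw [Fin.prod_univ_eq_prod_range (fun i : ℕ => listGamma a ((i : ℂ) + 1 + s)) K]
  induction K with
  | zero => simp
  | succ n ih =>
    rw [Finset.prod_range_succ, mul_right_comm, ← ih, mul_comm]
    simp only [listG, listGamma]
    rw [← Finset.prod_mul_distrib]
    refine Finset.prod_congr rfl fun l _ => ?_
    rw [← barnesG_add_one]
    · congr 1
      push_cast
      ring
    · intro m h
      refine ha l (n + m) ?_
      push_cast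
      linear_combination h

theorem listG_one_add_ne_zero {p : ℕ} (a : Fin p → ℂ) (s : ℂ)
    (ha : ∀ (l : Fin p) (n : ℕ), a l + s ≠ -((n : ℂ) + 1)) : listG a (1 + s) ≠ 0 :=
  Finset.prod_ne_zero_iff.2 fun l _ => barnesG_ne_zero fun n h => ha l n (by linear_combination h)

theorem prefactor_eq {p : ℕ} (a : Fin p → ℂ) (K : ℕ) (σ : ℂ)
    (ha : ∀ (i : Fin p) (n : ℕ), a i + σ ≠ -((n : ℂ) + 1) ∧ a i - σ ≠ -((n : ℂ) + 1)) :
    prefactor a K σ =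
      (∏ i : Fin K, listGamma a ((i : ℂ) + 1 + σ) * listGamma a ((i : ℂ) + 1 - σ)) *
        (Complex.Gamma (2 * σ) * Complex.Gamma (1 - 2 * σ)) ^ (2 * K) := by
  have h1 : ∀ (l : Fin p) (n : ℕ), a l + σ ≠ -((n : ℂ) + 1) := fun l n => (ha l n).1
  have h2 : ∀ (l : Fin p) (n : ℕ), a l + -σ ≠ -((n : ℂ) + 1) := fun l n => (ha l n).2
  have n1 := listG_one_add_ne_zero a σ h1
  have n2 := listG_one_add_ne_zero a (-σ) h2
  simp only [prefactor, sub_eq_add_neg _ σ]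
  rw [listG_add_natCast a σ h1, listG_add_natCast a (-σ) h2, Finset.prod_mul_distrib, mul_pow]
  field_simp

end Barnes

theorem nuIntegral_eq_tsum {p : ℕ} (a : Fin p → ℂ) (K : ℕ) (σ q : ℂ) {f : ℂ → ℂ}
    (hf : Summable fun s : Bool × ℕ => nuMass a K σ q s * f (nuAtom σ s)) :
    nuIntegral a K σ q f = ∑' s : Bool × ℕ, nuMass a K σ q s * f (nuAtom σ s) := by
  rw [hf.tsum_prod, tsum_bool]
  simp only [nuIntegral, nuMass, nuAtom, mul_assoc, tsum_mul_left]
  exact add_comm _ _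

theorem nuMultiIntegral_eq_tsum {p : ℕ} (a : Fin p → ℂ) (K : ℕ) (σ q : ℂ) :
    ∀ (n : ℕ) (f : (Fin n → ℂ) → ℂ), NuMultiConverges a K σ q n f →
      nuMultiIntegral a K σ q n f =
        ∑' s : Fin n → Bool × ℕ, (∏ i, nuMass a K σ q (s i)) * f (fun i => nuAtom σ (s i)) := by
  intro n
  induction n with
  | zero =>
    intro f _
    rw [tsum_fintype, Fintype.sum_unique, nuMultiIntegral]
    simp only [Finset.univ_eq_empty, Finset.prod_empty, one_mul]
    congr 1
    exact Subsingleton.elim _ _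
  | succ n ih =>
    intro f hf
    set e : (Bool × ℕ) × (Fin n → Bool × ℕ) ≃ (Fin (n + 1) → Bool × ℕ) :=
      Fin.consEquiv fun _ => Bool × ℕ
    have hterm : ∀ x : (Bool × ℕ) × (Fin n → Bool × ℕ),
        (∏ i, nuMass a K σ q (e x i)) * f (fun i => nuAtom σ (e x i)) =
        nuMass a K σ q x.1 * ((∏ i, nuMass a K σ q (x.2 i)) *
          f (Fin.cons (nuAtom σ x.1) fun i => nuAtom σ (x.2 i))) := by
      rintro ⟨x, y⟩
      have h1 : e (x, y) = Fin.cons x y := rfl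
      rw [h1, Fin.prod_univ_succ, mul_assoc]
      simp only [Fin.cons_zero, Fin.cons_succ]
      congr 3
      ext i
      refine Fin.cases ?_ (fun i => ?_) i <;> simp
    have hs : Summable fun x : (Bool × ℕ) × (Fin n → Bool × ℕ) =>
        nuMass a K σ q x.1 * ((∏ i, nuMass a K σ q (x.2 i)) *
          f (Fin.cons (nuAtom σ x.1) fun i => nuAtom σ (x.2 i))) :=
      ((e.summable_iff).2 hf).congr hterm
    have hinner : ∀ x : Bool × ℕ, ∑' y : Fin n → Bool × ℕ, nuMass a K σ q x *
        ((∏ i, nuMass a K σ q (y i)) * f (Fin.cons (nuAtom σ x) fun i => nuAtom σ (y i))) =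
        nuMass a K σ q x *
          nuMultiIntegral a K σ q n fun y => f (Fin.cons (nuAtom σ x) y) := by
      intro x
      rw [tsum_mul_left]
      by_cases hx : nuMass a K σ q x = 0
      · simp [hx]
      · rw [ih]
        exact (summable_mul_left_iff hx).1 (hs.prod_factor x)
    rw [← e.tsum_eq, tsum_congr hterm, hs.tsum_prod, tsum_congr hinner, nuMultiIntegral,
      nuIntegral_eq_tsum]
    exact hs.prod.congr hinner

/-- The number of atoms of the form `k + σ` in a configuration. -/
def plusCount {n : ℕ} (s : Fin n → Bool × ℕ) : ℕ := ∑ i, if (s i).1 then 1 else 0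

theorem plusCount_le {n : ℕ} (s : Fin n → Bool × ℕ) : plusCount s ≤ n :=
  (Finset.sum_le_sum fun i _ => (by split_ifs <;> simp : (if (s i).1 then 1 else 0) ≤ 1)).trans
    (by simp)

theorem prod_nuMass {p : ℕ} (a : Fin p → ℂ) (K : ℕ) (σ : ℂ) {q : ℂ} (hq : q ≠ 0) {n : ℕ}
    (s : Fin n → Bool × ℕ) :
    ∏ i, nuMass a K σ q (s i) = q ^ (2 * (plusCount s : ℤ) - n) * ∏ i, nuMass a K σ 1 (s i) := by
  have h1 : ∀ x : Bool × ℕ, nuMass a K σ q x =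
      q ^ (2 * ((if x.1 then 1 else 0 : ℕ) : ℤ) - 1) * nuMass a K σ 1 x := by
    rintro ⟨_ | _, k⟩ <;> simp [nuMass]
  simp_rw [h1, Finset.prod_mul_distrib]
  congr 1
  have h2 : 2 * (plusCount s : ℤ) - n =
      ∑ i : Fin n, (2 * ((if (s i).1 then 1 else 0 : ℕ) : ℤ) - 1) := by
    rw [Finset.sum_sub_distrib, ← Finset.mul_sum, plusCount]
    simp
  rw [h2]
  induction (Finset.univ : Finset (Fin n)) using Finset.cons_induction with
  | empty => simp
  | cons i t hi ih => rw [Finset.prod_cons, Finset.sum_cons, zpow_add₀ hq, ih]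

/-- The constant term in `q` of the multiple integral collects the configurations with as many
atoms `k + σ` as atoms `k - σ`. -/
theorem circleIntegral_nuMultiIntegral {p : ℕ} (a : Fin p → ℂ) (K : ℕ) (σ : ℂ) (m : ℕ)
    (f : (Fin (2 * m) → ℂ) → ℂ)
    (hconv : ∀ q : ℂ, ‖q‖ = 1 → NuMultiConverges a K σ q (2 * m) f) :
    CircleIntegrable (fun q : ℂ => nuMultiIntegral a K σ q (2 * m) f / q) 0 1 ∧
      1 / (2 * (Real.pi : ℂ) * Complex.I) *
        (∮ q in C(0, 1), nuMultiIntegral a K σ q (2 * m) f / q) =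
      ∑' s : Fin (2 * m) → Bool × ℕ, if plusCount s = m then
        (∏ i, nuMass a K σ 1 (s i)) * f (fun i => nuAtom σ (s i)) else 0 := by
  set T : (Fin (2 * m) → Bool × ℕ) → ℂ := fun s =>
    (∏ i, nuMass a K σ 1 (s i)) * f (fun i => nuAtom σ (s i)) with hT
  have hsum : Summable T := hconv 1 (by simp)
  have hsumk : ∀ k : ℕ, Summable fun s => if plusCount s = k then T s else 0 := fun k => by
    refine (hsum.indicator {s | plusCount s = k}).congr fun s => ?_
    simp [Set.indicator_apply]
  set c : ℕ → ℂ := fun k => ∑' s, if plusCount s = k then T s else 0 with hc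
  have hL : ∀ q : ℂ, ‖q‖ = 1 → nuMultiIntegral a K σ q (2 * m) f / q =
      ∑ k ∈ Finset.range (2 * m + 1), c k * (q - 0) ^ (2 * (k : ℤ) - 2 * m - 1) := by
    intro q hq
    have hq0 : q ≠ 0 := fun h => by simp [h] at hq
    have hs : ∀ s : Fin (2 * m) → Bool × ℕ,
        (∏ i, nuMass a K σ q (s i)) * f (fun i => nuAtom σ (s i)) =
        ∑ k ∈ Finset.range (2 * m + 1),
          q ^ (2 * (k : ℤ) - 2 * m) * if plusCount s = k then T s else 0 := by
      intro s
      rw [Finset.sum_eq_single_of_mem (plusCount s)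
        (Finset.mem_range.2 (Nat.lt_succ_of_le (plusCount_le s)))
        fun k _ hk => by rw [if_neg hk.symm, mul_zero], if_pos rfl, prod_nuMass a K σ hq0]
      push_cast
      rw [mul_assoc]
    rw [nuMultiIntegral_eq_tsum a K σ q _ f (hconv q hq), tsum_congr hs,
      Summable.tsum_finsetSum fun k _ => (hsumk k).mul_left _, Finset.sum_div]
    refine Finset.sum_congr rfl fun k _ => ?_
    rw [tsum_mul_left, sub_zero, zpow_sub_one₀ hq0, div_eq_mul_inv]
    ring
  have hI : ∀ k : ℕ, CircleIntegrable
      (fun q : ℂ => c k * (q - 0) ^ (2 * (k : ℤ) - 2 * m - 1)) 0 1 := fun k => by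
    refine CircleIntegrable.const_smul (a := c k) ?_
    rw [circleIntegrable_sub_zpow_iff]
    simp
  constructor
  · have h := CircleIntegrable.sum (Finset.range (2 * m + 1)) fun k _ => hI k
    have e : (fun θ : ℝ => (∑ k ∈ Finset.range (2 * m + 1), fun q : ℂ =>
        c k * (q - 0) ^ (2 * (k : ℤ) - 2 * m - 1)) (circleMap 0 1 θ)) =
        fun θ => nuMultiIntegral a K σ (circleMap 0 1 θ) (2 * m) f / circleMap 0 1 θ := by
      funext θ
      rw [hL _ (by simp), Finset.sum_apply]
    unfold CircleIntegrable at h ⊢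
    rwa [e] at h
  · rw [circleIntegral.integral_congr zero_le_one fun q hq => hL q (by simpa using hq),
      circleIntegral.integral_fun_sum fun k _ => hI k]
    simp_rw [circleIntegral.integral_const_mul]
    rw [Finset.sum_eq_single_of_mem m (Finset.mem_range.2 (by omega)) fun k _ hk => by
      rw [circleIntegral.integral_sub_zpow_of_ne (by omega), mul_zero]]
    have h1 : (2 * (m : ℤ) - 2 * m - 1) = -1 := by ring
    simp_rw [h1, zpow_neg_one]
    rw [circleIntegral.integral_sub_center_inv 0 one_ne_zero, mul_comm (c m), ← mul_assoc,
      one_div_mul_cancel Complex.two_pi_I_ne_zero, one_mul]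

theorem shiftedRow_strictAnti (K : ℕ) (lam : YoungDiagram) : StrictAnti (shiftedRow K lam) := by
  intro i j hij
  have h1 := lam.rowLen_anti i j hij.le
  have h2 : (i : ℕ) < j := hij
  have h3 := j.isLt
  unfold shiftedRow
  omega

theorem eq_of_range_shiftedRow_eq {K : ℕ} {lam mu : YoungDiagram} (hl : lam.colLen 0 ≤ K)
    (hm : mu.colLen 0 ≤ K) (h : Set.range (shiftedRow K lam) = Set.range (shiftedRow K mu)) :
    lam = mu := by
  have h1 : shiftedRow K lam ∘ Fin.rev = shiftedRow K mu ∘ Fin.rev := by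
    rw [← StrictMono.range_inj ((shiftedRow_strictAnti K lam).comp Fin.rev_strictAnti)
      ((shiftedRow_strictAnti K mu).comp Fin.rev_strictAnti),
      Fin.rev_surjective.range_comp, Fin.rev_surjective.range_comp, h]
  have h2 : ∀ i, lam.rowLen i = mu.rowLen i := by
    intro i
    by_cases hi : i < K
    · have := congrFun h1 (Fin.rev ⟨i, hi⟩)
      simpa [shiftedRow] using this
    · rw [rowLen_eq_zero hl (not_lt.1 hi), rowLen_eq_zero hm (not_lt.1 hi)]
  ext ⟨i, j⟩
  rw [YoungDiagram.mem_cells, YoungDiagram.mem_cells, YoungDiagram.mem_iff_lt_rowLen,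
    YoungDiagram.mem_iff_lt_rowLen, h2]

theorem exists_rowLen_eq {K : ℕ} (w : Fin K → ℕ) (hw : Antitone w) :
    ∃ lam : YoungDiagram, lam.colLen 0 ≤ K ∧ ∀ i : Fin K, lam.rowLen i = w i := by
  have hmem : ∀ c : ℕ × ℕ, c ∈ YoungDiagram.ofRowLens (List.ofFn w) hw.sortedGE_ofFn ↔
      ∃ h : c.1 < K, c.2 < w ⟨c.1, h⟩ := by
    intro c
    simp [YoungDiagram.mem_ofRowLens]
  refine ⟨YoungDiagram.ofRowLens (List.ofFn w) hw.sortedGE_ofFn, ?_, fun i => ?_⟩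
  · by_contra h
    have := (hmem (K, 0)).1 (YoungDiagram.mem_iff_lt_colLen.2 (not_le.1 h))
    exact absurd this.1 (lt_irrefl K)
  · refine eq_of_forall_lt_iff fun j => ?_
    rw [← YoungDiagram.mem_iff_lt_rowLen, hmem]
    simp

theorem strictMono_add_le {K : ℕ} {f : Fin K → ℕ} (hf : StrictMono f) (d : ℕ) :
    ∀ i j : Fin K, (j : ℕ) = i + d → f i + d ≤ f j := by
  induction d with
  | zero =>
    intro i j h
    rw [Fin.ext h]
    simp
  | succ d ih =>
    intro i j h
    have hj := j.isLt
    have h1 := ih i ⟨i + d, by omega⟩ rfl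
    have h2 : f ⟨i + d, by omega⟩ < f j := hf (by rw [Fin.lt_def]; simp only; omega)
    omega

theorem exists_range_shiftedRow_eq {K : ℕ} (A : Finset ℕ) (hA : A.card = K) :
    ∃ lam : YoungDiagram, lam.colLen 0 ≤ K ∧ Set.range (shiftedRow K lam) = A := by
  set f := A.orderEmbOfFin hA
  have hf : StrictMono f := f.strictMono
  have hlow : ∀ i : Fin K, (i : ℕ) ≤ f i := fun i => by
    have h0 : 0 < K := i.pos
    have := strictMono_add_le hf i ⟨0, h0⟩ i (by simp)
    omega
  obtain ⟨lam, hl, hr⟩ := exists_rowLen_eq (fun i : Fin K => f i.rev - (K - 1 - i)) (by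
    intro i j hij
    have h1 : (i : ℕ) ≤ j := hij
    have h2 := strictMono_add_le hf (j - i) j.rev i.rev (by simp only [Fin.val_rev]; omega)
    have h3 := hlow j.rev
    have h4 := j.isLt
    simp only [Fin.val_rev] at h3 ⊢
    omega)
  refine ⟨lam, hl, ?_⟩
  have e : shiftedRow K lam = f ∘ Fin.rev := by
    funext i
    have h3 := hlow i.rev
    simp only [Fin.val_rev] at h3
    rw [shiftedRow, hr, Function.comp_apply]
    omega
  rw [e, Fin.rev_surjective.range_comp, Finset.range_orderEmbOfFin]

theorem sum_shiftedRow {K : ℕ} {lam : YoungDiagram} (hl : lam.colLen 0 ≤ K) :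
    2 * ∑ i, shiftedRow K lam i = 2 * lam.card + K * (K - 1) := by
  simp only [shiftedRow]
  rw [Finset.sum_add_distrib, ← card_eq_sum_rowLen hl, mul_add,
    Fin.sum_univ_eq_sum_range (fun i => K - 1 - i), Finset.sum_range_reflect (fun i => i),
    mul_comm 2 (∑ i ∈ _, _), Finset.sum_range_id_mul_two]

/-- The configuration of `2K` distinct atoms attached to a pair of partitions. -/
def particles (K : ℕ) (lam mu : YoungDiagram) (i : Fin (2 * K)) : Bool × ℕ :=
  Fin.append (fun j => (true, shiftedRow K mu j)) (fun j => (false, shiftedRow K lam j))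
    (Fin.cast (two_mul K) i)

theorem particles_castAdd (K : ℕ) (lam mu : YoungDiagram) (j : Fin K) :
    particles K lam mu (Fin.cast (two_mul K).symm (Fin.castAdd K j)) =
      (true, shiftedRow K mu j) := by
  rw [particles, Fin.cast_cast, Fin.cast_eq_self, Fin.append_left]

theorem particles_natAdd (K : ℕ) (lam mu : YoungDiagram) (j : Fin K) :
    particles K lam mu (Fin.cast (two_mul K).symm (Fin.natAdd K j)) =
      (false, shiftedRow K lam j) := by
  rw [particles, Fin.cast_cast, Fin.cast_eq_self, Fin.append_right]

@[to_additive]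
theorem prod_particles {M : Type*} [CommMonoid M] (f : Bool × ℕ → M) (K : ℕ)
    (lam mu : YoungDiagram) : ∏ i, f (particles K lam mu i) =
      (∏ i, f (true, shiftedRow K mu i)) * ∏ i, f (false, shiftedRow K lam i) := by
  rw [← Equiv.prod_comp (finCongr (two_mul K).symm), Fin.prod_univ_add]
  simp only [finCongr_apply, particles_castAdd, particles_natAdd]

theorem range_particles (K : ℕ) (lam mu : YoungDiagram) (x : Bool × ℕ) :
    x ∈ Set.range (particles K lam mu) ↔
      (x.1 = true ∧ x.2 ∈ Set.range (shiftedRow K mu)) ∨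
        (x.1 = false ∧ x.2 ∈ Set.range (shiftedRow K lam)) := by
  constructor
  · rintro ⟨i, rfl⟩
    obtain ⟨i, rfl⟩ := (finCongr (two_mul K).symm).surjective i
    rw [finCongr_apply]
    refine Fin.addCases (fun j => ?_) (fun j => ?_) i
    · rw [particles_castAdd]
      exact Or.inl ⟨rfl, j, rfl⟩
    · rw [particles_natAdd]
      exact Or.inr ⟨rfl, j, rfl⟩
  · obtain ⟨b, k⟩ := x
    rintro (⟨rfl, j, rfl⟩ | ⟨rfl, j, rfl⟩)
    · exact ⟨_, particles_castAdd K lam mu j⟩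
    · exact ⟨_, particles_natAdd K lam mu j⟩

theorem particles_injective (K : ℕ) (lam mu : YoungDiagram) :
    Function.Injective (particles K lam mu) := by
  refine Function.Injective.comp (Fin.append_injective_iff.2 ⟨fun i j h => ?_, fun i j h => ?_,
    fun i j h => ?_⟩) (Fin.cast_injective (two_mul K))
  · exact (shiftedRow_strictAnti K mu).injective (congrArg Prod.snd h)
  · exact (shiftedRow_strictAnti K lam).injective (congrArg Prod.snd h)
  · exact absurd (congrArg Prod.fst h) (by simp)

theorem plusCount_comp_perm {n : ℕ} (s : Fin n → Bool × ℕ) (π : Equiv.Perm (Fin n)) :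
    plusCount (s ∘ π) = plusCount s :=
  Equiv.sum_comp π fun i => if (s i).1 then 1 else 0

theorem plusCount_particles (K : ℕ) (lam mu : YoungDiagram) :
    plusCount (particles K lam mu) = K := by
  rw [plusCount, sum_particles fun x : Bool × ℕ => if x.1 then 1 else 0]
  simp

/-- The orderings of the configurations attached to pairs of partitions. -/
def orderedParticles (K : ℕ) (x : (ShortPartition K × ShortPartition K) × Equiv.Perm (Fin (2 * K))) :
    Fin (2 * K) → Bool × ℕ := particles K x.1.1.1 x.1.2.1 ∘ x.2

theorem orderedParticles_injective (K : ℕ) : Function.Injective (orderedParticles K) := by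
  rintro ⟨⟨⟨l, hl⟩, ⟨m, hm⟩⟩, π⟩ ⟨⟨⟨l', hl'⟩, ⟨m', hm'⟩⟩, π'⟩ h
  simp only [orderedParticles] at h
  have hr : Set.range (particles K l m) = Set.range (particles K l' m') := by
    rw [← π.surjective.range_comp (particles K l m), ← π'.surjective.range_comp (particles K l' m'), h]
  have hx : ∀ x, x ∈ Set.range (particles K l m) ↔ x ∈ Set.range (particles K l' m') := by
    rw [hr]; simp
  simp only [range_particles] at hx
  have el : l = l' := eq_of_range_shiftedRow_eq hl hl' (by
    ext k; simpa only [Bool.false_eq_true, false_and, false_or, true_and] using hx (false, k))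
  have em : m = m' := eq_of_range_shiftedRow_eq hm hm' (by
    ext k; simpa only [Bool.true_eq_false, false_and, or_false, true_and] using hx (true, k))
  subst el em
  have : π = π' := Equiv.ext fun i => particles_injective K l m (congrFun h i)
  rw [this]

theorem mem_range_orderedParticles {K : ℕ} {s : Fin (2 * K) → Bool × ℕ}
    (hs : Function.Injective s) (hc : plusCount s = K) : s ∈ Set.range (orderedParticles K) := by
  have hcard : ∀ b : Bool, ((Finset.univ.filter fun i => (s i).1 = b).image fun i => (s i).2).card =
      (Finset.univ.filter fun i => (s i).1 = b).card := fun b => by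
    refine Finset.card_image_of_injOn fun i hi j hj hij => hs ?_
    simp only [Finset.coe_filter, Finset.mem_univ, true_and, Set.mem_ofPred_eq] at hi hj
    exact Prod.ext (hi.trans hj.symm) hij
  have ht : (Finset.univ.filter fun i => (s i).1 = true).card = K := by
    rw [Finset.card_filter]
    exact hc
  have hf : (Finset.univ.filter fun i => (s i).1 = false).card = K := by
    have h1 := Finset.card_filter_add_card_filter_not (s := (Finset.univ : Finset (Fin (2 * K))))
      (fun i => (s i).1 = true)
    simp only [Bool.not_eq_true, Finset.card_univ, Fintype.card_fin] at h1
    omega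
  obtain ⟨mu, hm, hmr⟩ := exists_range_shiftedRow_eq _ ((hcard true).trans ht)
  obtain ⟨lam, hl, hlr⟩ := exists_range_shiftedRow_eq _ ((hcard false).trans hf)
  have hsub : ∀ i, s i ∈ Set.range (particles K lam mu) := by
    intro i
    rw [range_particles, hmr, hlr]
    rcases h : (s i).1
    · right
      simp only [Finset.coe_image, Set.mem_image, Finset.coe_filter, Finset.mem_univ, true_and]
      exact ⟨i, h, rfl⟩
    · left
      simp only [Finset.coe_image, Set.mem_image, Finset.coe_filter, Finset.mem_univ, true_and]
      exact ⟨i, h, rfl⟩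
  choose g hg using hsub
  have hginj : Function.Injective g := fun i j hij => hs (by rw [← hg i, ← hg j, hij])
  refine ⟨⟨⟨⟨lam, hl⟩, ⟨mu, hm⟩⟩, Equiv.ofBijective g (Finite.injective_iff_bijective.1 hginj)⟩, ?_⟩
  funext i
  exact hg i

theorem prod_Ioi_sub_sq_comp_perm {n : ℕ} (x : Fin n → ℂ) (π : Equiv.Perm (Fin n)) :
    ∏ i, ∏ j ∈ Finset.Ioi i, (x (π i) - x (π j)) ^ 2 = ∏ i, ∏ j ∈ Finset.Ioi i, (x i - x j) ^ 2 := by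
  have h : ∀ y : Fin n → ℂ, ∏ i, ∏ j ∈ Finset.Ioi i, (y i - y j) ^ 2 =
      (Matrix.vandermonde y).det ^ 2 := by
    intro y
    rw [Matrix.det_vandermonde, ← Finset.prod_pow]
    refine Finset.prod_congr rfl fun i _ => ?_
    rw [← Finset.prod_pow]
    refine Finset.prod_congr rfl fun j _ => ?_
    ring
  have h2 : Matrix.vandermonde (x ∘ π) = (Matrix.vandermonde x).submatrix π id := rfl
  rw [h x]
  have := h (x ∘ π)
  simp only [Function.comp_apply] at this
  rw [this, h2, Matrix.det_permute, mul_pow]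
  rcases Int.units_eq_one_or (Equiv.Perm.sign π) with h | h <;> simp [h]

theorem matrixIntegrand_comp_perm (u : ℂ) {n : ℕ} (x : Fin n → ℂ) (π : Equiv.Perm (Fin n)) :
    matrixIntegrand u n (x ∘ π) = matrixIntegrand u n x := by
  simp only [matrixIntegrand, Function.comp_apply]
  rw [prod_Ioi_sub_sq_comp_perm, Equiv.sum_comp π x]

theorem matrixIntegrand_eq_zero (u : ℂ) {n : ℕ} {x : Fin n → ℂ} (hx : ¬ Function.Injective x) :
    matrixIntegrand u n x = 0 := by
  simp only [Function.Injective, not_forall] at hx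
  obtain ⟨i, j, hij, hne⟩ := hx
  wlog hlt : i < j generalizing i j
  · exact this j i hij.symm (Ne.symm hne) (lt_of_le_of_ne (not_lt.1 hlt) (Ne.symm hne))
  rw [matrixIntegrand, Finset.prod_eq_zero (Finset.mem_univ i), zero_mul]
  rw [Finset.prod_eq_zero (Finset.mem_Ioi.2 hlt)]
  rw [hij]
  simp

theorem prod_Ioi_append {m n : ℕ} (x : Fin m → ℂ) (y : Fin n → ℂ) :
    ∏ i, ∏ j ∈ Finset.Ioi i, (Fin.append x y i - Fin.append x y j) ^ 2 =
      (∏ i, ∏ j ∈ Finset.Ioi i, (x i - x j) ^ 2) * (∏ i, ∏ j ∈ Finset.Ioi i, (y i - y j) ^ 2) *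
        ∏ i, ∏ j, (x i - y j) ^ 2 := by
  have h : ∀ {k : ℕ} (g : Fin k → Fin k → ℂ),
      ∏ i, ∏ j ∈ Finset.Ioi i, g i j = ∏ i, ∏ j, if i < j then g i j else 1 := by
    intro k g
    refine Finset.prod_congr rfl fun i _ => ?_
    rw [← Finset.prod_filter]
    congr 1
    ext
    simp
  have h1 : ∀ i j, Fin.castAdd n i < Fin.castAdd n j ↔ (i : Fin m) < j := fun _ _ => Iff.rfl
  have h2 : ∀ i j, Fin.natAdd m i < Fin.natAdd m j ↔ (i : Fin n) < j := fun i j => by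
    rw [Fin.lt_def, Fin.lt_def, Fin.val_natAdd, Fin.val_natAdd, Nat.add_lt_add_iff_left]
  have h3 : ∀ (i : Fin m) (j : Fin n), Fin.castAdd n i < Fin.natAdd m j := fun i j => by
    rw [Fin.lt_def, Fin.val_castAdd, Fin.val_natAdd]
    omega
  have h4 : ∀ (i : Fin m) (j : Fin n), ¬ Fin.natAdd m j < Fin.castAdd n i := fun i j =>
    not_lt.2 (h3 i j).le
  simp only [h, Fin.prod_univ_add, Fin.append_left, Fin.append_right, h1, h2, h3, h4, if_true,
    if_false, Finset.prod_const_one, Finset.prod_mul_distrib]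
  ring

theorem matrixIntegrand_cast (u : ℂ) {m n : ℕ} (h : m = n) (x : Fin n → ℂ) :
    matrixIntegrand u m (fun i => x (Fin.cast h i)) = matrixIntegrand u n x := by
  subst h
  rfl

theorem nuAtom_append {K : ℕ} (σ : ℂ) (m l : Fin K → ℕ) (i : Fin (K + K)) :
    nuAtom σ (Fin.append (fun j => (true, m j)) (fun j => (false, l j)) i) =
      Fin.append (fun j => (m j : ℂ) + σ) (fun j => (l j : ℂ) - σ) i := by
  refine Fin.addCases (fun j => ?_) (fun j => ?_) i
  · rw [Fin.append_left, Fin.append_left, nuAtom]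
  · rw [Fin.append_right, Fin.append_right, nuAtom]

theorem matrixIntegrand_particles (u σ : ℂ) {K : ℕ} {lam mu : YoungDiagram}
    (hl : lam.colLen 0 ≤ K) (hm : mu.colLen 0 ≤ K) :
    matrixIntegrand u (2 * K) (fun i => nuAtom σ (particles K lam mu i)) =
      ((∏ i : Fin K, ∏ k ∈ Finset.Ioi i, ((shiftedRow K mu i : ℂ) - shiftedRow K mu k) ^ 2) *
        (∏ i : Fin K, ∏ k ∈ Finset.Ioi i, ((shiftedRow K lam i : ℂ) - shiftedRow K lam k) ^ 2) *
        ∏ i : Fin K, ∏ j : Fin K,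
          ((shiftedRow K mu i : ℂ) + σ - (shiftedRow K lam j - σ)) ^ 2) *
        (Complex.exp u ^ (lam.card + mu.card) * Complex.exp u ^ (K * (K - 1))) := by
  simp only [particles]
  rw [matrixIntegrand_cast u (two_mul K) (fun i => nuAtom σ (Fin.append
    (fun j => (true, shiftedRow K mu j)) (fun j => (false, shiftedRow K lam j)) i))]
  simp only [nuAtom_append]
  rw [matrixIntegrand, prod_Ioi_append, Fin.sum_univ_add, ← pow_add, ← Complex.exp_nat_mul]
  simp only [add_sub_add_right_eq_sub, sub_sub_sub_cancel_right, Fin.append_left, Fin.append_right]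
  congr 2
  rw [Finset.sum_add_distrib, Finset.sum_sub_distrib, mul_comm]
  congr 1
  have h1 := sum_shiftedRow hl
  have h2 := sum_shiftedRow hm
  have h3 : ∑ i, shiftedRow K mu i + ∑ i, shiftedRow K lam i =
      lam.card + mu.card + K * (K - 1) := by omega
  rw [← h3]
  push_cast
  ring

theorem prod_nuMass_particles {p : ℕ} (a : Fin p → ℂ) (K : ℕ) (σ : ℂ) (lam mu : YoungDiagram) :
    ∏ i, nuMass a K σ 1 (particles K lam mu i) =
      (∏ i : Fin K, weight a K σ (shiftedRow K mu i + σ)) *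
        ∏ i : Fin K, weight a K σ (shiftedRow K lam i - σ) := by
  rw [prod_particles]
  simp [nuMass]

end PainleveBlock

theorem theorem2 {p : ℕ} (a : Fin p → ℂ) (K : ℕ) (hK : 1 ≤ K) (σ : ℂ)
    (hσ : ∀ n : ℤ, 2 * σ ≠ (n : ℂ))
    (ha : ∀ (i : Fin p) (n : ℕ), a i + σ ≠ -((n : ℂ) + 1) ∧ a i - σ ≠ -((n : ℂ) + 1))
    (t u : ℂ) (hu : Complex.exp u = t)
    (hconv : ∀ q : ℂ, ‖q‖ = 1 → NuMultiConverges a K σ q (2 * K) (matrixIntegrand u (2 * K))) :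
    CircleIntegrable
        (fun q : ℂ => nuMultiIntegral a K σ q (2 * K) (matrixIntegrand u (2 * K)) / q) 0 1 ∧
      HasSum
        (fun x : ShortPartition K × ShortPartition K =>
          blockCoeff a σ x.1.1 x.2.1 * t ^ (x.1.1.card + x.2.1.card))
        (prefactor a K σ / t ^ (K * (K - 1)) * (1 / ((2 * K).factorial : ℂ)) *
          (1 / (2 * (Real.pi : ℂ) * Complex.I) *
            ∮ q in C(0, 1),
              nuMultiIntegral a K σ q (2 * K) (matrixIntegrand u (2 * K)) / q)) := by
  obtain ⟨hint, heq⟩ := circleIntegral_nuMultiIntegral a K σ K _ hconv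
  refine ⟨hint, ?_⟩
  rw [heq]
  set T : (Fin (2 * K) → Bool × ℕ) → ℂ := fun s =>
    (∏ i, nuMass a K σ 1 (s i)) * matrixIntegrand u (2 * K) (fun i => nuAtom σ (s i)) with hT
  have hsum : Summable fun s => if plusCount s = K then T s else 0 := by
    refine ((hconv 1 (by simp)).indicator {s | plusCount s = K}).congr fun s => ?_
    simp [Set.indicator_apply, hT]
  have h1 := ((orderedParticles_injective K).hasSum_iff (fun s hs => by
    rw [ite_eq_right_iff]
    intro hc
    have hs' : ¬ Function.Injective s := fun h => hs (mem_range_orderedParticles h hc)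
    simp only [hT]
    rw [matrixIntegrand_eq_zero, mul_zero]
    exact fun h => hs' (Function.Injective.of_comp (f := nuAtom σ) h))).2 hsum.hasSum
  have hterm : ∀ (x : ShortPartition K × ShortPartition K) (π : Equiv.Perm (Fin (2 * K))),
      ((fun s => if plusCount s = K then T s else 0) ∘ orderedParticles K) (x, π) =
        T (particles K x.1.1 x.2.1) := by
    intro x π
    have hc : plusCount (orderedParticles K (x, π)) = K :=
      (plusCount_comp_perm _ π).trans (plusCount_particles K _ _)
    rw [Function.comp_apply, if_pos hc]
    simp only [hT, orderedParticles, Function.comp_apply]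
    rw [Equiv.prod_comp π fun i => nuMass a K σ 1 (particles K x.1.1 x.2.1 i)]
    congr 1
    exact matrixIntegrand_comp_perm u (fun i => nuAtom σ (particles K x.1.1 x.2.1 i)) π
  have h2 := h1.prod_fiberwise (g := fun x => ((2 * K).factorial : ℂ) * T (particles K x.1.1 x.2.1))
    fun x => by
      simp only [hterm]
      convert hasSum_fintype fun _ : Equiv.Perm (Fin (2 * K)) => T (particles K x.1.1 x.2.1) using 1
      rw [Finset.sum_const, Finset.card_univ, Fintype.card_perm, Fintype.card_fin, nsmul_eq_mul]
  have ht : t ≠ 0 := hu ▸ Complex.exp_ne_zero u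
  have hfac : ((2 * K).factorial : ℂ) ≠ 0 := by exact_mod_cast (2 * K).factorial_ne_zero
  refine Eq.subst (motive := fun f => HasSum f _) (funext fun x => Eq.symm ?_)
    (h2.mul_left (prefactor a K σ / t ^ (K * (K - 1)) * (1 / ((2 * K).factorial : ℂ))))
  simp only [hT]
  rw [blockCoeff_eq a hσ ha x.1.2 x.2.2, ← prefactor_eq a K σ ha,
    prod_nuMass_particles, matrixIntegrand_particles u σ x.1.2 x.2.2, hu]
  field_simp
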